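/- Let $G=(V,E)$ be a finite undirected (simple) graph with $n=|V|$ nodes, let $f$ be an integer with $0<f<n$, and let $L,U,\epsilon$ be real numbers with $U-L>\epsilon>0$. Consider the asynchronous local broadcast model on $G$: every node $u$ runs a deterministic state machine that may depend on $u$, $G$, $f$, $L$, $U$ and $\epsilon$; there is no clock; the nodes proceed at arbitrary varying speeds (every non-faulty node keeps taking steps); each message sent by a node is received, identically and correctly, by all its neighbors, each of which knows the sender, after an unbounded but finite delay, and every link is FIFO; at most $f$ nodes are Byzantine faulty and behave arbitrarily, except that their messages, too, are received identically by all their neighbors. An algorithm solves $\epsilon$-approximate Byzantine consensus on $G$ tolerating at most $f$ Byzantine faulty nodes if, for all real inputs of the nodes in $[L,U]$, every set of at most $f$ faulty nodes and every execution: (agreement) the outputs of any two non-faulty nodes differ by at most $\epsilon$; (validity) the output of each non-faulty node lies in the convex hull of the inputs of the non-faulty nodes; (termination) every non-faulty node decides on an output in finite time. If there exists an algorithm that solves $\epsilon$-approximate Byzantine consensus on $G$ under this model tolerating at most $f$ Byzantine faulty nodes, then $G$ is $(2f+1)$-connected, that is, $n>2f+1$ and $G$ remains connected whenever at most $2f$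 of its vertices are removed. -/

import Mathlib

universe u v w

set_option linter.checkUnivs false

namespace AsyncBroadcast

/-- A deterministic distributed algorithm for the nodes `V`: one state machine per node. The family
of machines is arbitrary, so each node may know the graph, its own name, the bounds on the inputs,
the tolerance and the number of faults. There is no clock: a transition depends on the local state
and on the received message only. -/
structure Algorithm (V : Type u) where
  /-- The messages. -/
  Msg : Type v
  /-- The local states of each node. -/
  State : V → Type w
  /-- The state in which a node starts, given its input. -/
  start : (a : V) → ℝ → State a
  /-- One step of node `a`: it receives at most one message, whose sender it knows, changes its
  state and broadcasts a finite list of messages, in this order, to its neighbors. -/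
  step : (a : V) → State a → Option (V × Msg) → State a × List Msg
  /-- The output of a node, `none` as long as it is undecided. -/
  output : (a : V) → State a → Option ℝ
  /-- A decision is final. (A node that takes no further steps after its decision is one whose
  later transitions keep the state and broadcast nothing.) -/
  output_stable : ∀ (a : V) (s : State a) (r : Option (V × Msg)) (y : ℝ),
    output a s = some y → output a (step a s r).1 = some y

/-- What can happen at one moment of an execution. -/
inductive Event (V : Type u) (M : Type v) where
  /-- Nothing happens. -/
  | idle : Event V M
  /-- The non-faulty node `a` takes a step without receiving a message. -/
  | tick (a : V) : Event V M
  /-- The non-faulty node `b` receives the next message on the link from `a` and takes a step. -/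
  | deliver (a b : V) : Event V M
  /-- The faulty node `a` broadcasts an arbitrary list of messages. -/
  | byzantine (a : V) (ms : List M) : Event V M

/-- A global configuration. Under local broadcast a message goes identically to all neighbors, so
there is one list of sent messages per node, and on the FIFO link from `a` to `b` only the number
of messages received so far has to be recorded. The entry `state a` of a faulty node `a` plays no
role. -/
structure Config {V : Type u} (A : Algorithm.{u, v, w} V) where
  /-- The local states. -/
  state : (a : V) → A.State a
  /-- `sent a` lists all messages broadcast by `a` so far, in order. -/
  sent : V → List A.Msg
  /-- `received a b` is the number of messages of `a` that `b` has received so far. -/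
  received : V → V → ℕ

namespace Algorithm

variable {V : Type u} [DecidableEq V] (A : Algorithm.{u, v, w} V)

/-- The configuration in which every node is in its start state and nothing has been sent. -/
def startConfig (input : V → ℝ) : Config A where
  state a := A.start a (input a)
  sent _ := []
  received _ _ := 0

/-- Node `a` executes one step of its state machine, with the received message `r` if any. -/
def exec (c : Config A) (a : V) (r : Option (V × A.Msg)) : Config A where
  state := Function.update c.state a (A.step a (c.state a) r).1
  sent := Function.update c.sent a (c.sent a ++ (A.step a (c.state a) r).2)
  received := c.received

/-- The effect of an event on a configuration. A delivery on a link on which no message is waiting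
has no effect. -/
def next (c : Config A) : Event V A.Msg → Config A
  | .idle => c
  | .tick a => A.exec c a none
  | .deliver a b =>
      match (c.sent a)[c.received a b]? with
      | none => c
      | some m =>
          A.exec { c with
            received := Function.update c.received a
              (Function.update (c.received a) b (c.received a b + 1)) } b (some (a, m))
  | .byzantine a ms => { c with sent := Function.update c.sent a (c.sent a ++ ms) }

/-- The configuration after the first `t` events of the sequence `e`. -/
def config (input : V → ℝ) (e : ℕ → Event V A.Msg) : ℕ → Config A
  | 0 => A.startConfig input
  | t + 1 => A.next (config input e t) (e t)

end Algorithm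

/-- The events that are possible on the network `G` when `F` is the set of faulty nodes: non-faulty
nodes follow the algorithm, messages travel along edges, and only faulty nodes broadcast
arbitrarily. Receptions by faulty nodes are not recorded: faulty nodes behave arbitrarily,
whatever they receive. -/
def Event.Possible {V : Type u} {M : Type v} (G : SimpleGraph V) (F : Finset V) :
    Event V M → Prop
  | .idle => True
  | .tick a => a ∉ F
  | .deliver a b => G.Adj a b ∧ b ∉ F
  | .byzantine a _ => a ∈ F

namespace Algorithm

variable {V : Type u} [DecidableEq V] (A : Algorithm.{u, v, w} V)

/-- The executions of `A` in the asynchronous system on `G` with set `F` of faulty nodes: all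
infinite sequences of possible events in which every non-faulty node keeps taking steps (at an
arbitrary, varying speed), and every message that has been broadcast is received after a finite
delay by every (non-faulty) neighbor of its sender. -/
structure IsExecution (G : SimpleGraph V) (F : Finset V) (input : V → ℝ)
    (e : ℕ → Event V A.Msg) : Prop where
  possible : ∀ t, (e t).Possible G F
  keeps_stepping : ∀ a, a ∉ F → ∀ t, ∃ t', t ≤ t' ∧ e t' = .tick a
  delivers : ∀ a b, G.Adj a b → b ∉ F → ∀ t k, k < ((A.config input e t).sent a).length →
    ∃ t', k < (A.config input e t').received a b

/-- In the execution `e`, node `a` decides on the output `y` at some (finite) time. -/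
def Decides (input : V → ℝ) (e : ℕ → Event V A.Msg) (a : V) (y : ℝ) : Prop :=
  ∃ t, A.output a ((A.config input e t).state a) = some y

/-- `A` solves `ε`-approximate Byzantine consensus on `G` in the asynchronous local broadcast model,
for inputs between `L` and `U`, tolerating at most `f` Byzantine faulty nodes. -/
def SolvesApproxConsensus (G : SimpleGraph V) (f : ℕ) (L U ε : ℝ) : Prop :=
  ∀ (F : Finset V) (input : V → ℝ) (e : ℕ → Event V A.Msg),
    F.card ≤ f → (∀ a, input a ∈ Set.Icc L U) → A.IsExecution G F input e →
      -- agreement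
      (∀ a b, a ∉ F → b ∉ F → ∀ y z, A.Decides input e a y → A.Decides input e b z →
        |y - z| ≤ ε) ∧
      -- validity
      (∀ a, a ∉ F → ∀ y, A.Decides input e a y → y ∈ convexHull ℝ (input '' {b | b ∉ F})) ∧
      -- termination
      (∀ a, a ∉ F → ∃ y, A.Decides input e a y)

end Algorithm

/-- `G` is `k`-(vertex-)connected: it has more than `k` vertices, and it stays connected when any
fewer than `k` vertices are removed. -/
def VertexConnected {V : Type u} [Fintype V] (G : SimpleGraph V) (k : ℕ) : Prop :=
  k < Fintype.card V ∧
    ∀ S : Finset V, S.card < k → (G.induce {a | a ∉ S}).Connected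

end AsyncBroadcast

/-! An indistinguishability argument. Suppose disjoint nonempty sets `X` and `Y` hear, apart from
themselves and a common set `C`, only from `D` and `D'` respectively, where `C`, `D`, `D'` have at
most `f` nodes. Let `C` be faulty and silent, with input `L` on `X` and `U` elsewhere; every node
outside `C` must decide. Up to the decision of a node of `X`, the nodes of `X` see the same thing
when all inputs are `L`, the nodes of `D` are faulty and replay their broadcasts, and `C` is
non-faulty but slow. Validity forces the output `L` (`decides_eq`). Symmetrically `Y` outputs `U`,
against agreement (`false_of_separated`). Asynchrony makes slow and crashed nodes look alike; since
the replay is the same for all neighbors, local broadcast does not prevent it.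

Such sets exist if `n ≤ 2f + 1` or if at most `2f` vertices disconnect `G`. -/

namespace AsyncBroadcast

/-! ### Fair schedules -/

section Fair

variable {V : Type u}

/-- Every non-faulty node steps, and every link to a non-faulty node is served, infinitely
often. -/
structure IsFair {M : Type v} (G : SimpleGraph V) (F : Finset V) (e : ℕ → Event V M) : Prop where
  tick : ∀ a, a ∉ F → ∀ t, ∃ t', t ≤ t' ∧ e t' = .tick a
  deliver : ∀ a b, G.Adj a b → b ∉ F → ∀ t, ∃ t', t ≤ t' ∧ e t' = .deliver a b

/-- There is a fair sequence of events in which the faulty nodes are silent. -/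
theorem exists_isFair_silent [Finite V] (M : Type v) (G : SimpleGraph V) (F : Finset V) :
    ∃ e : ℕ → Event V M, IsFair G F e ∧ (∀ t, (e t).Possible G F) ∧
      ∀ t a ms, e t ≠ .byzantine a ms := by
  classical
  let ev : Option (V ⊕ V × V) → Event V M
    | none => .idle
    | some (.inl a) => .tick a
    | some (.inr (a, b)) => .deliver a b
  obtain ⟨g, hg⟩ := exists_surjective_nat (Option (V ⊕ V × V))
  -- The first component of `t.unpair` takes each value infinitely often, so every possible event
  -- recurs.
  let e : ℕ → Event V M := fun t =>
    if (ev (g t.unpair.1)).Possible G F then ev (g t.unpair.1) else .idle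
  have he : ∀ i, (ev i).Possible G F → ∀ t, ∃ t', t ≤ t' ∧ e t' = ev i := by
    intro i hi t
    obtain ⟨n, rfl⟩ := hg i
    exact ⟨Nat.pair n t, Nat.right_le_pair n t, by simp [e, hi]⟩
  refine ⟨e, ⟨fun a ha => he (some (.inl a)) ha,
    fun a b hab hb => he (some (.inr (a, b))) ⟨hab, hb⟩⟩, fun t => ?_, fun t a ms => ?_⟩
  · by_cases h : (ev (g t.unpair.1)).Possible G F
    · simpa only [e, if_pos h] using h
    · simp only [e, if_neg h]; trivial
  · by_cases h : (ev (g t.unpair.1)).Possible G F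
    · simp only [e, if_pos h]
      rcases g t.unpair.1 with _ | _ | _ <;> simp [ev]
    · simp [e, if_neg h]

end Fair

/-! ### Message delivery along an event sequence -/

section Execution

variable {V : Type u} [DecidableEq V] (A : Algorithm.{u, v, w} V)

theorem Algorithm.sent_prefix_next (c : Config A) (ev : Event V A.Msg) (a : V) :
    c.sent a <+: (A.next c ev).sent a := by
  have hexec : ∀ (c : Config A) b r, c.sent a <+: (A.exec c b r).sent a := by
    intro c b r
    by_cases h : a = b
    · subst h; simp [Algorithm.exec]
    · simp [Algorithm.exec, h]
  cases ev with
  | idle => simp [Algorithm.next]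
  | tick b => exact hexec c b none
  | deliver b d =>
    simp only [Algorithm.next]
    split
    · simp
    · exact hexec _ _ _
  | byzantine b ms =>
    by_cases h : a = b
    · subst h; simp [Algorithm.next]
    · simp [Algorithm.next, h]

theorem Algorithm.received_le_next (c : Config A) (ev : Event V A.Msg) (a b : V) :
    c.received a b ≤ (A.next c ev).received a b := by
  cases ev with
  | idle => simp [Algorithm.next]
  | tick d => simp [Algorithm.next, Algorithm.exec]
  | deliver p q =>
    simp only [Algorithm.next]
    split
    · simp
    · by_cases hp : a = p
      · subst hp
        by_cases hq : b = q
        · subst hq; simp [Algorithm.exec]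
        · simp [Algorithm.exec, hq]
      · simp [Algorithm.exec, hp]
  | byzantine d ms => simp [Algorithm.next]

theorem Algorithm.sent_length_mono (input : V → ℝ) (e : ℕ → Event V A.Msg) (a : V) :
    Monotone fun t => ((A.config input e t).sent a).length :=
  monotone_nat_of_le_succ fun t => (A.sent_prefix_next _ (e t) a).length_le

theorem Algorithm.received_mono (input : V → ℝ) (e : ℕ → Event V A.Msg) (a b : V) :
    Monotone fun t => (A.config input e t).received a b :=
  monotone_nat_of_le_succ fun t => A.received_le_next _ (e t) a b

/-- A message that has been sent is received if its link is served infinitely often. -/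
theorem Algorithm.received_of_frequently_deliver (input : V → ℝ) (e : ℕ → Event V A.Msg) (a b : V)
    (h : ∀ t, ∃ t', t ≤ t' ∧ e t' = .deliver a b) (t k : ℕ)
    (hk : k < ((A.config input e t).sent a).length) :
    ∃ t', k < (A.config input e t').received a b := by
  suffices H : ∀ j, j ≤ k + 1 → ∃ t', t ≤ t' ∧ j ≤ (A.config input e t').received a b by
    obtain ⟨t', -, h'⟩ := H (k + 1) le_rfl
    exact ⟨t', h'⟩
  intro j
  induction j with
  | zero => exact fun _ => ⟨t, le_rfl, Nat.zero_le _⟩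
  | succ j ih =>
    intro hj
    obtain ⟨s, hts, hs⟩ := ih (by omega)
    obtain ⟨s', hss', hs'⟩ := h s
    have hr := A.received_mono input e a b hss'
    have hl := A.sent_length_mono input e a (hts.trans hss')
    simp only at hr hl
    by_cases hlt : j < (A.config input e s').received a b
    · exact ⟨s', hts.trans hss', hlt⟩
    · have hlen : (A.config input e s').received a b < ((A.config input e s').sent a).length := by
        omega
      refine ⟨s' + 1, by omega, ?_⟩
      simp only [Algorithm.config, hs', Algorithm.next, List.getElem?_eq_getElem hlen,
        Algorithm.exec, Function.update_self]
      omega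

/-- Fairness concerns the events alone, not the configurations, so a fair tail can be appended to
any finite prefix of possible events. -/
theorem IsFair.isExecution {A : Algorithm.{u, v, w} V} {G : SimpleGraph V} {F : Finset V}
    {e : ℕ → Event V A.Msg} (h : IsFair G F e) (hp : ∀ t, (e t).Possible G F) (input : V → ℝ) :
    A.IsExecution G F input e where
  possible := hp
  keeps_stepping := h.tick
  delivers a b hab hb := A.received_of_frequently_deliver input e a b (h.deliver a b hab hb)

/-! ### Indistinguishable executions -/

/-- The event by which the event `ev`, leading from `c` to `c'`, is imitated as seen from `X`: the
nodes in `X` do the same, the nodes in `D` are faulty and broadcast the same messages, and the other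
nodes do nothing. -/
def Event.imitate {A : Algorithm.{u, v, w} V} (X D : Finset V) (c c' : Config A) :
    Event V A.Msg → Event V A.Msg
  | .tick a =>
      if a ∈ X then .tick a
      else if a ∈ D then .byzantine a ((c'.sent a).drop (c.sent a).length) else .idle
  | .deliver a b =>
      if b ∈ X then .deliver a b
      else if b ∈ D then .byzantine b ((c'.sent b).drop (c.sent b).length) else .idle
  | .idle => .idle
  | .byzantine _ _ => .idle

theorem Event.Possible.imitate {A : Algorithm.{u, v, w} V} {G : SimpleGraph V} {C X D : Finset V}
    (hXD : Disjoint X D) (c c' : Config A) {ev : Event V A.Msg} (h : ev.Possible G C) :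
    (ev.imitate X D c c').Possible G D := by
  cases ev with
  | idle => trivial
  | byzantine a ms => trivial
  | tick a =>
    simp only [Event.imitate]
    split_ifs with hX hD
    · exact Finset.disjoint_left.mp hXD hX
    · exact hD
    · trivial
  | deliver a b =>
    simp only [Event.imitate]
    split_ifs with hX hD
    · exact ⟨h.1, Finset.disjoint_left.mp hXD hX⟩
    · exact hD
    · trivial

/-- The configurations `c` and `d` look the same to the nodes in `X`, which hear from `W` only. -/
structure Config.Agree {A : Algorithm.{u, v, w} V} (X W : Finset V) (c d : Config A) : Prop where
  state : ∀ a ∈ X, d.state a = c.state a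
  sent : ∀ a ∈ W, d.sent a = c.sent a
  received : ∀ a ∈ W, ∀ b ∈ X, d.received a b = c.received a b

variable {A}

theorem Config.Agree.exec {X W : Finset V} {c d : Config A} (h : c.Agree X W d) {a : V}
    (ha : a ∈ X) (r : Option (V × A.Msg)) : (A.exec c a r).Agree X W (A.exec d a r) where
  state b hb := by
    by_cases hba : b = a
    · subst hba; simp [Algorithm.exec, h.state b hb]
    · simp [Algorithm.exec, hba, h.state b hb]
  sent b hb := by
    by_cases hba : b = a
    · subst hba; simp [Algorithm.exec, h.state b ha, h.sent b hb]
    · simp [Algorithm.exec, hba, h.sent b hb]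
  received := h.received

/-- A step of `a` outside `X` can affect `X` only through what `a` broadcasts. If `a` is in `D`, the
appended suffix is replayed; otherwise `a` is not in `W`, and its messages do not matter. -/
theorem Algorithm.exec_agree_right {X W : Finset V} {c c' d : Config A} (h : c.Agree X W d)
    (a : V) (ha : a ∉ X) (hs : ∀ b, b ≠ a → c'.sent b = c.sent b)
    (hst : ∀ b, b ≠ a → c'.state b = c.state b)
    (hr : ∀ b, ∀ q, q ≠ a → c'.received b q = c.received b q)
    (hp : c.sent a <+: c'.sent a) {D : Finset V} (hW : a ∈ W → a ∈ D) :
    c'.Agree X W (A.next d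
      (if a ∈ D then .byzantine a ((c'.sent a).drop (c.sent a).length) else .idle)) := by
  have hne : ∀ b ∈ X, b ≠ a := fun b hb hba => ha (hba ▸ hb)
  split_ifs with hD
  · refine ⟨fun b hb => ?_, fun b hb => ?_, fun p hpW q hq => ?_⟩
    · simp [Algorithm.next, h.state b hb, hst b (hne b hb)]
    · by_cases hba : b = a
      · subst hba
        simpa [Algorithm.next, h.sent b hb] using List.prefix_iff_eq_append.mp hp
      · simp [Algorithm.next, hba, h.sent b hb, hs b hba]
    · simp [Algorithm.next, h.received p hpW q hq, hr p q (hne q hq)]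
  · refine ⟨fun b hb => ?_, fun b hb => ?_, fun p hpW q hq => ?_⟩
    · simp [Algorithm.next, h.state b hb, hst b (hne b hb)]
    · have hba : b ≠ a := fun hba => hD (hW (hba ▸ hb))
      simp [Algorithm.next, h.sent b hb, hs b hba]
    · simp [Algorithm.next, h.received p hpW q hq, hr p q (hne q hq)]

theorem Config.Agree.imitate {G : SimpleGraph V} {X D C : Finset V}
    (hN : ∀ a b, G.Adj a b → b ∈ X → a ∈ X ∪ D ∪ C) {c d : Config A}
    (h : c.Agree X (X ∪ D ∪ C) d) {ev : Event V A.Msg} (hp : ev.Possible G C)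
    (hbyz : ∀ a ms, ev ≠ .byzantine a ms) :
    (A.next c ev).Agree X (X ∪ D ∪ C) (A.next d (ev.imitate X D c (A.next c ev))) := by
  cases ev with
  | idle => exact h
  | byzantine a ms => exact absurd rfl (hbyz a ms)
  | tick a =>
    simp only [Event.imitate]
    by_cases ha : a ∈ X
    · rw [if_pos ha]
      exact h.exec ha none
    · rw [if_neg ha]
      refine Algorithm.exec_agree_right h a ha ?_ ?_ ?_ (A.sent_prefix_next _ _ _) ?_
      · intro b hb; simp [Algorithm.next, Algorithm.exec, hb]
      · intro b hb; simp [Algorithm.next, Algorithm.exec, hb]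
      · intro b q _; simp [Algorithm.next, Algorithm.exec]
      -- Nodes of `C` never step in the original execution, so a stepping node of `W` outside `X`
      -- lies in `D`.
      · intro hW
        simpa [ha, show a ∉ C from hp] using hW
  | deliver a b =>
    simp only [Event.imitate]
    by_cases hb : b ∈ X
    · rw [if_pos hb]
      have haW := hN a b hp.1 hb
      simp only [Algorithm.next, h.sent a haW, h.received a haW b hb]
      split
      · exact h
      · refine Config.Agree.exec ?_ hb _
        refine ⟨h.state, h.sent, fun p hpW q hq => ?_⟩
        by_cases hpa : p = a
        · subst hpa
          by_cases hqb : q = b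
          · subst hqb; simp
          · simp [hqb, h.received p hpW q hq]
        · simp [hpa, h.received p hpW q hq]
    · rw [if_neg hb]
      refine Algorithm.exec_agree_right h b hb ?_ ?_ ?_ (A.sent_prefix_next _ _ _) ?_
      · intro p hpb
        simp only [Algorithm.next]
        split <;> simp [Algorithm.exec, hpb]
      · intro p hpb
        simp only [Algorithm.next]
        split <;> simp [Algorithm.exec, hpb]
      · intro p q hqb
        simp only [Algorithm.next]
        split
        · rfl
        · by_cases hpa : p = a
          · subst hpa; simp [Algorithm.exec, hqb]
          · simp [Algorithm.exec, hpa]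
      · intro hW
        simpa [hb, show b ∉ C from hp.2] using hW

/-- In an execution in which the faulty nodes `C` are silent, nodes in `X` cannot rule out that all
non-faulty inputs are equal to their own, if at most `f` nodes outside `X` and `C` are adjacent
to `X`. -/
theorem Algorithm.SolvesApproxConsensus.decides_eq [Finite V] {G : SimpleGraph V} {f : ℕ}
    {L U ε : ℝ} (hA : A.SolvesApproxConsensus G f L U ε) {X D C : Finset V} (hD : D.card ≤ f)
    (hXD : Disjoint X D)
    (hN : ∀ a b, G.Adj a b → b ∈ X → a ∈ X ∪ D ∪ C) {input : V → ℝ} {v : ℝ}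
    (hv : v ∈ Set.Icc L U) (hX : ∀ a ∈ X, input a = v) {e : ℕ → Event V A.Msg}
    (he : ∀ t, (e t).Possible G C) (hbyz : ∀ t a ms, e t ≠ .byzantine a ms) {x : V} (hx : x ∈ X)
    {y : ℝ} (hy : A.Decides input e x y) : y = v := by
  obtain ⟨T, hT⟩ := hy
  obtain ⟨g, hg, hgp, -⟩ := exists_isFair_silent A.Msg G D
  -- Before `T` the nodes of `C` are merely slow; from `T` on, the schedule `g` lets them step and
  -- delivers all delayed messages.
  let e' : ℕ → Event V A.Msg := fun t =>
    if t < T then (e t).imitate X D (A.config input e t) (A.config input e (t + 1)) else g t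
  have he' : ∀ t, T ≤ t → e' t = g t := fun t ht => if_neg (not_lt.mpr ht)
  have hlate : ∀ {ev}, (∀ t, ∃ t', t ≤ t' ∧ g t' = ev) → ∀ t, ∃ t', t ≤ t' ∧ e' t' = ev := by
    intro ev h t
    obtain ⟨t', ht', h'⟩ := h (max t T)
    exact ⟨t', (le_max_left _ _).trans ht', (he' t' ((le_max_right _ _).trans ht')).trans h'⟩
  have hfair : IsFair G D e' :=
    ⟨fun a ha => hlate (hg.tick a ha), fun a b hab hb => hlate (hg.deliver a b hab hb)⟩
  have hposs : ∀ t, (e' t).Possible G D := by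
    intro t
    by_cases ht : t < T
    · simpa only [e', if_pos ht] using (he t).imitate hXD _ _
    · simpa only [e', if_neg ht] using hgp t
  have hagree : ∀ t ≤ T,
      (A.config input e t).Agree X (X ∪ D ∪ C) (A.config (fun _ => v) e' t) := by
    intro t
    induction t with
    | zero =>
      refine fun _ => ⟨fun a ha => ?_, fun _ _ => rfl, fun _ _ _ _ => rfl⟩
      simp [Algorithm.config, Algorithm.startConfig, hX a ha]
    | succ t ih =>
      intro ht
      have := (ih (by omega)).imitate hN (he t) (hbyz t)
      simpa only [Algorithm.config, e', if_pos (Nat.lt_of_succ_le ht)] using this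
  have hdec : A.Decides (fun _ => v) e' x y :=
    ⟨T, by rw [(hagree T le_rfl).state x hx]; exact hT⟩
  have hmem := (hA D (fun _ => v) e' hD (fun _ => hv) (hfair.isExecution hposs _)).2.1 x
    (Finset.disjoint_left.mp hXD hx) y hdec
  have hsub : (fun _ : V => v) '' {b | b ∉ D} ⊆ {v} := by
    rintro _ ⟨_, _, rfl⟩; rfl
  simpa using convexHull_mono hsub hmem

/-- Two nodes cannot agree if silencing `C` leaves each of them unable to tell whether
the other's input is real. -/
theorem Algorithm.SolvesApproxConsensus.false_of_separated [Finite V] {G : SimpleGraph V} {f : ℕ}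
    {L U ε : ℝ} (hε : 0 < ε) (hLU : ε < U - L) (hA : A.SolvesApproxConsensus G f L U ε)
    {X Y C D D' : Finset V} (hX : X.Nonempty) (hY : Y.Nonempty) (hXY : Disjoint X Y)
    (hXC : Disjoint X C) (hYC : Disjoint Y C) (hXD : Disjoint X D) (hYD : Disjoint Y D')
    (hC : C.card ≤ f) (hD : D.card ≤ f) (hD' : D'.card ≤ f)
    (hNX : ∀ a b, G.Adj a b → b ∈ X → a ∈ X ∪ D ∪ C)
    (hNY : ∀ a b, G.Adj a b → b ∈ Y → a ∈ Y ∪ D' ∪ C) : False := by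
  obtain ⟨x, hx⟩ := hX
  obtain ⟨y, hy⟩ := hY
  obtain ⟨e, hfair, hposs, hbyz⟩ := exists_isFair_silent A.Msg G C
  let input : V → ℝ := fun a => if a ∈ X then L else U
  have hL : L ∈ Set.Icc L U := ⟨le_rfl, by linarith⟩
  have hU : U ∈ Set.Icc L U := ⟨by linarith, le_rfl⟩
  have hin : ∀ a, input a ∈ Set.Icc L U := by
    intro a
    by_cases ha : a ∈ X
    · simpa only [input, if_pos ha] using hL
    · simpa only [input, if_neg ha] using hU
  obtain ⟨hagr, -, hterm⟩ := hA C input e hC hin (hfair.isExecution hposs input)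
  have hxC := Finset.disjoint_left.mp hXC hx
  have hyC := Finset.disjoint_left.mp hYC hy
  obtain ⟨p, hp⟩ := hterm x hxC
  obtain ⟨q, hq⟩ := hterm y hyC
  have hpL : p = L := hA.decides_eq hD hXD hNX hL (fun a ha => if_pos ha) hposs hbyz hx hp
  have hqU : q = U := hA.decides_eq hD' hYD hNY hU
    (fun a ha => if_neg (Finset.disjoint_right.mp hXY ha)) hposs hbyz hy hq
  have := hagr x y hxC hyC p q hp hq
  rw [hpL, hqU, abs_sub_comm] at this
  linarith [le_abs_self (U - L)]

end Execution

variable {V : Type u} [Fintype V] [DecidableEq V] {A : Algorithm.{u, v, w} V} {G : SimpleGraph V}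
  {f : ℕ} {L U ε : ℝ}

theorem Algorithm.SolvesApproxConsensus.lt_card (hf : 0 < f) (hfn : f < Fintype.card V)
    (hε : 0 < ε) (hLU : ε < U - L) (hA : A.SolvesApproxConsensus G f L U ε) :
    2 * f + 1 < Fintype.card V := by
  by_contra! hn
  obtain ⟨x, y, hxy⟩ := Fintype.exists_pair_of_one_lt_card (by omega : 1 < Fintype.card V)
  let R : Finset V := {x, y}ᶜ
  have hR : R.card = Fintype.card V - 2 := by
    rw [Finset.card_compl, Finset.card_pair hxy]
  -- Here `R` has at most `2f - 1` nodes, so at most `f - 1` remain outside `C`, leaving room for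
  -- one more in `D` and in `D'`.
  obtain ⟨C, hCR, hC⟩ := Finset.exists_subset_card_eq (min_le_right f R.card)
  have hRC : (R \ C).card = R.card - C.card := Finset.card_sdiff_of_subset hCR
  have hxR : x ∉ R := by simp [R]
  have hyR : y ∉ R := by simp [R]
  have hcover : ∀ a, a = x ∨ a = y ∨ a ∈ R := fun a => by
    simp only [R, Finset.mem_compl, Finset.mem_insert, Finset.mem_singleton]; tauto
  have hcard : ∀ z, (insert z (R \ C)).card ≤ f := fun z =>
    (Finset.card_insert_le _ _).trans (by omega)
  refine hA.false_of_separated hε hLU (X := {x}) (Y := {y}) (C := C) (D := insert y (R \ C))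
    (D' := insert x (R \ C)) (by simp) (by simp) (by simpa using hxy)
    (by simpa using fun h => hxR (hCR h)) (by simpa using fun h => hyR (hCR h))
    (by simp [hxy, hxR]) (by simp [hxy.symm, hyR]) (by omega) (hcard y) (hcard x) ?_ ?_ <;>
  · intro a _ _ _
    rcases hcover a with h | h | h <;> by_cases a ∈ C <;> simp [*]

theorem Algorithm.SolvesApproxConsensus.vertexConnected (hf : 0 < f) (hfn : f < Fintype.card V)
    (hε : 0 < ε) (hLU : ε < U - L) (hA : A.SolvesApproxConsensus G f L U ε) :
    VertexConnected G (2 * f + 1) := by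
  classical
  have hn := hA.lt_card hf hfn hε hLU
  refine ⟨hn, fun S hS => ?_⟩
  have : Nonempty {a // a ∉ S} := by
    by_contra hemp
    have hall : S = Finset.univ := by simpa [Finset.eq_univ_iff_forall] using hemp
    rw [hall, Finset.card_univ] at hS
    omega
  refine (SimpleGraph.connected_iff _).mpr ⟨fun x y => ?_, this⟩
  by_contra hxy
  -- The cut `S` has at most `2f` nodes, so `C` and `S \ C` both have at most `f`.
  obtain ⟨C, hCS, hC⟩ := Finset.exists_subset_card_eq (min_le_right f S.card)
  have hSC : (S \ C).card = S.card - C.card := Finset.card_sdiff_of_subset hCS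
  let H := G.induce {a | a ∉ S}
  -- `X` is the component of `x` after removing `S`, and `Y` is everything else outside `S`; no edge
  -- joins them.
  let X : Finset V := Finset.univ.filter fun a => ∃ h : a ∉ S, H.Reachable x ⟨a, h⟩
  let Y : Finset V := Finset.univ.filter fun a => ∃ h : a ∉ S, ¬ H.Reachable x ⟨a, h⟩
  have hXS : Disjoint X S := Finset.disjoint_left.mpr fun a ha => by
    obtain ⟨h, -⟩ := (Finset.mem_filter.mp ha).2
    exact h
  have hYS : Disjoint Y S := Finset.disjoint_left.mpr fun a ha => by
    obtain ⟨h, -⟩ := (Finset.mem_filter.mp ha).2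
    exact h
  have hXY : Disjoint X Y := Finset.disjoint_left.mpr fun a ha hb => by
    obtain ⟨h, hr⟩ := (Finset.mem_filter.mp ha).2
    obtain ⟨_, hr'⟩ := (Finset.mem_filter.mp hb).2
    exact hr' hr
  have hmem : ∀ a, a ∈ S → ∀ Z : Finset V, a ∈ Z ∪ S \ C ∪ C := fun a ha Z => by
    by_cases a ∈ C <;> simp [*]
  refine hA.false_of_separated hε hLU (X := X) (Y := Y) (C := C) (D := S \ C) (D' := S \ C)
    ⟨x, Finset.mem_filter.mpr ⟨Finset.mem_univ _, x.2, .refl _⟩⟩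
    ⟨y, Finset.mem_filter.mpr ⟨Finset.mem_univ _, y.2, hxy⟩⟩ hXY
    (hXS.mono_right hCS) (hYS.mono_right hCS) (hXS.mono_right Finset.sdiff_subset)
    (hYS.mono_right Finset.sdiff_subset) (by omega) (by omega) (by omega) ?_ ?_
  · intro a b hab hb
    obtain ⟨hbS, hr⟩ := (Finset.mem_filter.mp hb).2
    by_cases haS : a ∈ S
    · exact hmem a haS X
    · have hadj : H.Adj ⟨b, hbS⟩ ⟨a, haS⟩ := hab.symm
      exact Finset.mem_union_left _ (Finset.mem_union_left _
        (Finset.mem_filter.mpr ⟨Finset.mem_univ _, haS, hr.trans hadj.reachable⟩))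
  · intro a b hab hb
    obtain ⟨hbS, hr⟩ := (Finset.mem_filter.mp hb).2
    by_cases haS : a ∈ S
    · exact hmem a haS Y
    · have hadj : H.Adj ⟨a, haS⟩ ⟨b, hbS⟩ := hab
      exact Finset.mem_union_left _ (Finset.mem_union_left _
        (Finset.mem_filter.mpr ⟨Finset.mem_univ _, haS, fun h => hr (h.trans hadj.reachable)⟩))

end AsyncBroadcast

theorem theorem2 {V : Type u} [Fintype V] [DecidableEq V] (G : SimpleGraph V)
    (f : ℕ) (hf : 0 < f) (hfn : f < Fintype.card V)
    (L U ε : ℝ) (hε : 0 < ε) (hLU : ε < U - L)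
    (h : ∃ A : AsyncBroadcast.Algorithm.{u, v, w} V, A.SolvesApproxConsensus G f L U ε) :
    AsyncBroadcast.VertexConnected G (2 * f + 1) := by
  obtain ⟨A, hA⟩ := h
  exact hA.vertexConnected hf hfn hε hLU
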